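/- There are universal constants $C>0$ and $k\in\mathbb{N}$ such that the following holds. Let $m\ge 1$, $d\ge 2$, $n\ge 1$ be integers, let $G_\phi, W_1,\bar R_X\ge 0$, $B\in\mathbb{R}$ and $\delta\in(0,1)$. Let $\mathcal{X}$ be the set of matrices $X\in\mathbb{R}^{m\times d}$ all of whose rows satisfy $\|X_j\|_\infty\le \bar R_X$, let $\mathcal{Y}\subseteq\mathbb{R}^m$, and let $\mathcal{F}_1=\{w\in\mathbb{R}^d : \|w\|_1\le W_1\}$, where $w$ stands for the linear scoring function $X\mapsto Xw$. Let $\phi:\mathbb{R}^m\times\mathcal{Y}\to[0,\infty)$ be a (not necessarily convex) loss, measurable in its second argument, such that $|\phi(s,y)-\phi(s',y)|\le G_\phi\|s-s'\|_\infty$ for all $y\in\mathcal{Y}$, $s,s'\in\mathbb{R}^m$, and $\phi(Xw,y)\le B$ for all $w\in\mathcal{F}_1$, $X\in\mathcal{X}$, $y\in\mathcal{Y}$. Let $(X^{(1)},y^{(1)}),\dots,(X^{(n)},y^{(n)})$ be drawn i.i.d. from a probability distribution $D$ on $\mathcal{X}\times\mathcal{Y}$, and write $L_\phi(w)=\mathbb{E}_{(X,y)\sim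 D}[\phi(Xw,y)]$, $\hat L_\phi(w)=\frac1n\sum_{i=1}^n\phi(X^{(i)}w,y^{(i)})$ and $$\Delta = C\,(1+\log(mn))^k\left(G_\phi W_1\bar R_X\sqrt{\frac{\log d}{n}}+B\sqrt{\frac{\log(1/\delta)}{n}}\right).$$ Then with probability at least $1-\delta$ over the sample, $$\forall w\in\mathcal{F}_1,\qquad L_\phi(w)\le \hat L_\phi(w)+\Delta ,$$ and with probability at least $1-2\delta$, $$L_\phi(\hat w)\le L_\phi(w^\star)+\Delta$$ for every minimizer $\hat w$ of $\hat L_\phi$ over $\mathcal{F}_1$ and every minimizer $w^\star$ of $L_\phi$ over $\mathcal{F}_1$. -/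

import Mathlib

open MeasureTheory

namespace LearningToRank

/-- The input space: the `m × d` real matrices, given by their rows `X j` (one feature vector per
document), all of whose rows have `ℓ^∞` norm at most `R`. The norm on `Fin d → ℝ` is the sup norm.
The product sigma-algebra on `Fin m → Fin d → ℝ` is the Borel one. -/
def InputSpace (m d : ℕ) (R : ℝ) : Set (Fin m → Fin d → ℝ) :=
  {X | ∀ j : Fin m, ‖X j‖ ≤ R}

/-- The weight vectors `w` that parameterize the class of linear scoring functions `X ↦ X w`
with `‖w‖₁ ≤ W`. -/
def L1Class (d : ℕ) (W : ℝ) : Set (Fin d → ℝ) :=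
  {w | ∑ i, |w i| ≤ W}

/-- An example `(X, y)`: an input matrix with bounded rows and a label vector in `Y ⊆ ℝ^m`. -/
abbrev Example (m d : ℕ) (R : ℝ) (Y : Set (Fin m → ℝ)) : Type :=
  InputSpace m d R × Y

/-- `φ` is Lipschitz with constant `G` in the score vector, with respect to the sup norm
(the norm on `Fin m → ℝ`), uniformly over the labels. -/
def IsLipschitzLoss {m : ℕ} {Y : Set (Fin m → ℝ)} (φ : (Fin m → ℝ) → Y → ℝ) (G : ℝ) : Prop :=
  ∀ (y : Y) (s s' : Fin m → ℝ), |φ s y - φ s' y| ≤ G * ‖s - s'‖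

/-- The loss of the linear scoring function with weight vector `w` on one example. -/
def exampleLoss {m d : ℕ} {R : ℝ} {Y : Set (Fin m → ℝ)} (φ : (Fin m → ℝ) → Y → ℝ)
    (w : Fin d → ℝ) (z : Example m d R Y) : ℝ :=
  φ (Matrix.mulVec (Matrix.of z.1.1) w) z.2

/-- The expected loss `L_φ(w)`. -/
noncomputable def expectedLoss {m d : ℕ} {R : ℝ} {Y : Set (Fin m → ℝ)}
    (φ : (Fin m → ℝ) → Y → ℝ) (D : Measure (Example m d R Y)) (w : Fin d → ℝ) : ℝ :=
  ∫ z, exampleLoss φ w z ∂D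

/-- The empirical loss of `w` on a sample of size `n`. -/
noncomputable def empiricalLoss {m d n : ℕ} {R : ℝ} {Y : Set (Fin m → ℝ)}
    (φ : (Fin m → ℝ) → Y → ℝ) (S : Fin n → Example m d R Y) (w : Fin d → ℝ) : ℝ :=
  (1 / (n : ℝ)) * ∑ i, exampleLoss φ w (S i)

/-- `w` minimizes `f` over the set `F`. -/
def IsMinimizerOver {α : Type*} (f : α → ℝ) (F : Set α) (w : α) : Prop :=
  w ∈ F ∧ ∀ v ∈ F, f w ≤ f v

/-- With `P`-probability at least `p`, the property `A` holds: `A` holds throughout a measurable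
event of probability at least `p`. -/
def HoldsWithProbAtLeast {Ω : Type*} [MeasurableSpace Ω] (P : Measure Ω) (p : ℝ)
    (A : Ω → Prop) : Prop :=
  ∃ E : Set Ω, MeasurableSet E ∧ ENNReal.ofReal p ≤ P E ∧ ∀ ω ∈ E, A ω

/-- The error term `C (1 + log (m n))^k (G W R √(log d / n) + B √(log (1/δ) / n))`. -/
noncomputable def errorTerm (C : ℝ) (k m d n : ℕ) (G W R B δ : ℝ) : ℝ :=
  C * (1 + Real.log ((m : ℝ) * (n : ℝ))) ^ k *
    (G * W * R * √(Real.log (d : ℝ) / (n : ℝ)) + B * √(Real.log (1 / δ) / (n : ℝ)))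

end LearningToRank

open LearningToRank

namespace LearningToRank

open Finset BigOperators

/-! The loss is Lipschitz in the sup norm of the scores, so approximating the scores of all `n * m`
sample rows controls all sample losses at once, with no convexity of `φ`. By Maurey's argument
(`exists_small_sums`), averages of `k` atoms of the `ℓ¹` ball approximate any `w` on these rows with
error of order `W R √(log (n m) / k)`, and there are at most `(2d+1)^k` such averages. Taking `k =
4^s` gives dyadic nets. In the chaining sum, Massart's lemma charges every level the same amount, so
about `log n` levels cost only a logarithmic factor (`exists_majorant_exampleLoss`).

Symmetrization (`integral_supDev_le`) turns this Rademacher bound into a bound on the expected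
largest deviation, and McDiarmid (`bounded_differences_upper_tail`) adds the confidence term. The
supremum runs over a countable dense set of weights, hence is measurable; continuity in `w` recovers
the whole ball. For the excess risk, a minimizer of the expected loss is fixed before sampling, so
Hoeffding suffices for it, and the union bound costs a second `δ`.

Rademacher suprema over the class are replaced by majorants `M σ`, which need no boundedness
argument. -/

/-- The signed sum `∑ i, σ i * u i`. -/
noncomputable def signSum {n : ℕ} (σ : Fin n → ℤˣ) (u : Fin n → ℝ) : ℝ :=
  ∑ i, ((σ i : ℤ) : ℝ) * u i

/-! ### Rademacher sums: Massart's lemma and dyadic chaining. -/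

section SignSum

variable {n : ℕ}

lemma signSum_sub (σ : Fin n → ℤˣ) (u v : Fin n → ℝ) :
    signSum σ (u - v) = signSum σ u - signSum σ v := by
  simp [signSum, mul_sub, sum_sub_distrib]

lemma signSum_neg (σ : Fin n → ℤˣ) (u : Fin n → ℝ) : signSum (-σ) u = -signSum σ u := by
  simp [signSum]

lemma abs_sign_cast (s : ℤˣ) : |((s : ℤ) : ℝ)| = 1 := by
  rcases Int.units_eq_one_or s with h | h <;> simp [h]

lemma signSum_le (σ : Fin n → ℤˣ) {u : Fin n → ℝ} {c : ℝ} (h : ∀ i, |u i| ≤ c) :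
    signSum σ u ≤ n * c := by
  have : ∀ i ∈ (univ : Finset (Fin n)), ((σ i : ℤ) : ℝ) * u i ≤ c := fun i _ => by
    refine (le_abs_self _).trans ?_
    rw [abs_mul, abs_sign_cast, one_mul]
    exact h i
  simpa [signSum] using sum_le_sum this

lemma expect_signSum (u : Fin n → ℝ) : 𝔼 σ : Fin n → ℤˣ, signSum σ u = 0 := by
  have h := Fintype.expect_equiv (Equiv.neg (Fin n → ℤˣ)) (fun σ => signSum (-σ) u)
    (fun σ => signSum σ u) fun _ => rfl
  simp only [signSum_neg, expect_neg_distrib] at h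
  linarith

/-- The average factorizes over the coordinates, and each factor is a `cosh`. -/
lemma expect_exp_signSum_le (t : ℝ) (u : Fin n → ℝ) :
    𝔼 σ : Fin n → ℤˣ, Real.exp (t * signSum σ u) ≤ Real.exp (t ^ 2 * (∑ i, u i ^ 2) / 2) := by
  have hcard : (Fintype.card (Fin n → ℤˣ) : ℝ) = 2 ^ n := by simp
  rw [Fintype.expect_eq_sum_div_card, hcard, div_le_iff₀ (by positivity)]
  have h1 : ∀ σ : Fin n → ℤˣ, Real.exp (t * signSum σ u) =
      ∏ i, Real.exp (t * (((σ i : ℤ) : ℝ) * u i)) := fun σ => by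
    rw [signSum, mul_sum, Real.exp_sum]
  have h2 : ∀ i, ∑ s : ℤˣ, Real.exp (t * (((s : ℤ) : ℝ) * u i)) ≤
      2 * Real.exp (t ^ 2 * u i ^ 2 / 2) := fun i => by
    have := Real.cosh_le_exp_half_sq (t * u i)
    rw [Real.cosh_eq, mul_pow] at this
    rw [UnitsInt.univ, sum_insert (by decide)]
    simp
    linarith
  calc ∑ σ : Fin n → ℤˣ, Real.exp (t * signSum σ u)
      = ∏ i, ∑ s : ℤˣ, Real.exp (t * (((s : ℤ) : ℝ) * u i)) := by
        simp_rw [h1]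
        rw [Finset.prod_univ_sum, Fintype.piFinset_univ]
    _ ≤ ∏ i, 2 * Real.exp (t ^ 2 * u i ^ 2 / 2) :=
        prod_le_prod (fun i _ => sum_nonneg fun s _ => (Real.exp_pos _).le) fun i _ => h2 i
    _ = Real.exp (t ^ 2 * (∑ i, u i ^ 2) / 2) * 2 ^ n := by
        rw [prod_mul_distrib, ← Real.exp_sum, mul_sum, sum_div]
        simp [mul_comm]

/-- **Massart's finite class lemma**, for a majorant of the signed sums. -/
lemma exists_majorant_of_card_le {κ : Type*} (P : Finset κ) (a : κ → Fin n → ℝ) {r A : ℝ}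
    (hr : 0 ≤ r) (hA : 0 < A) (ha : ∀ k ∈ P, ∑ i, a k i ^ 2 ≤ r ^ 2)
    (hP : (P.card : ℝ) ≤ Real.exp A) :
    ∃ M : (Fin n → ℤˣ) → ℝ, (∀ σ, ∀ k ∈ P, signSum σ (a k) ≤ M σ) ∧
      𝔼 σ, M σ ≤ r * √(2 * A) := by
  rcases hr.eq_or_lt with rfl | hr
  · refine ⟨fun _ => 0, fun σ k hk => ?_, by simp⟩
    have h0 : ∀ i, a k i = 0 := fun i => by
      have h1 := single_le_sum (f := fun i => a k i ^ 2) (fun i _ => sq_nonneg _) (mem_univ i)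
      have h2 := ha k hk
      simp only [ne_eq, OfNat.ofNat_ne_zero, not_false_eq_true, zero_pow] at h2
      exact pow_eq_zero_iff two_ne_zero |>.1 (le_antisymm (h1.trans h2) (sq_nonneg _))
    simp [signSum, h0]
  -- This `t` minimizes `A / t + t * r ^ 2 / 2`, with minimum `r * √(2 * A)`.
  set t : ℝ := √(2 * A) / r
  have ht : 0 < t := by positivity
  set q : ℝ := A + t ^ 2 * r ^ 2 / 2
  -- The logarithm of the exponential sum is replaced by its tangent at `exp q`. The majorant is
  -- then affine in the exponential sum, and averaging needs no Jensen inequality.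
  refine ⟨fun σ => (1 / t) * ((∑ k ∈ P, Real.exp (t * signSum σ (a k))) / Real.exp q - 1 + q),
    fun σ k hk => ?_, ?_⟩
  · beta_reduce
    rw [one_div, ← div_eq_inv_mul, le_div_iff₀ ht]
    have h1 : Real.exp (t * signSum σ (a k)) ≤ ∑ k ∈ P, Real.exp (t * signSum σ (a k)) :=
      single_le_sum (f := fun k => Real.exp (t * signSum σ (a k)))
        (fun k _ => (Real.exp_pos _).le) hk
    have h2 := Real.add_one_le_exp (t * signSum σ (a k) - q)
    rw [Real.exp_sub] at h2
    have h3 := div_le_div_of_nonneg_right h1 (Real.exp_pos q).le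
    linarith
  · have h1 : 𝔼 σ : Fin n → ℤˣ, ∑ k ∈ P, Real.exp (t * signSum σ (a k)) ≤ Real.exp q := by
      rw [expect_sum_comm]
      calc _ ≤ ∑ k ∈ P, Real.exp (t ^ 2 * r ^ 2 / 2) := sum_le_sum fun k hk =>
            (expect_exp_signSum_le t (a k)).trans (Real.exp_le_exp.2 (by
              have := mul_le_mul_of_nonneg_left (ha k hk) (sq_nonneg t)
              linarith))
        _ = P.card * Real.exp (t ^ 2 * r ^ 2 / 2) := by simp
        _ ≤ Real.exp A * Real.exp (t ^ 2 * r ^ 2 / 2) := by gcongr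
        _ = Real.exp q := by rw [← Real.exp_add]
    rw [← mul_expect, expect_add_distrib, expect_sub_distrib, Fintype.expect_const,
      Fintype.expect_const, ← expect_div]
    have h2 : (𝔼 σ : Fin n → ℤˣ, ∑ k ∈ P, Real.exp (t * signSum σ (a k))) / Real.exp q ≤ 1 :=
      (div_le_one (Real.exp_pos q)).2 h1
    have h3 : t * (r * √(2 * A)) = q := by
      have hs : √(2 * A) ^ 2 = 2 * A := Real.sq_sqrt (by positivity)
      simp only [t, q]
      field_simp
      linarith
    rw [one_div, ← div_eq_inv_mul, div_le_iff₀ ht]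
    linarith

/-- **Chaining** along dyadic nets `T s` in the sup norm, starting from a single point. -/
lemma exists_majorant_of_nets {ι : Type*} (u : ι → Fin n → ℝ) (T : ℕ → Finset (Fin n → ℝ))
    (b : Fin n → ℝ) {A E : ℝ} (hA : 0 < A) (hE : 0 ≤ E) (h0 : T 0 = {b})
    (hcard : ∀ s, ((T s).card : ℝ) ≤ Real.exp (A * 4 ^ s))
    (hnet : ∀ s w, ∃ v ∈ T s, ∀ i, |u w i - v i| ≤ E / 2 ^ s) (S : ℕ) :
    ∃ M : (Fin n → ℤˣ) → ℝ, (∀ σ w, signSum σ (u w) ≤ M σ) ∧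
      𝔼 σ, M σ ≤ n * (E / 2 ^ S) + S * (6 * E * √n * √A) := by
  choose p hpT hp using hnet
  have key : ∀ S : ℕ, ∃ M : (Fin n → ℤˣ) → ℝ, (∀ σ w, signSum σ (p S w) ≤ M σ) ∧
      𝔼 σ, M σ ≤ S * (6 * E * √n * √A) := by
    intro S
    induction S with
    | zero =>
      -- The coarsest net is one point, whose signed sum averages to zero.
      refine ⟨fun σ => signSum σ b, fun σ w => ?_, by simp [expect_signSum]⟩
      have := hpT 0 w
      rw [h0, mem_singleton] at this
      rw [this]
    | succ S ih =>
      obtain ⟨M, hM, hM'⟩ := ih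
      -- Consecutive approximants differ by at most `E / 2 ^ (S + 1) + E / 2 ^ S`.
      set e : ℝ := 3 * E / 2 ^ (S + 1)
      have he : 0 ≤ e := by positivity
      classical
      set P := (T (S + 1) ×ˢ T S).filter fun q => ∀ i, |q.1 i - q.2 i| ≤ e
      obtain ⟨N, hN, hN'⟩ := exists_majorant_of_card_le P (fun q => q.1 - q.2)
        (r := √n * e) (A := 2 * A * 4 ^ (S + 1)) (by positivity) (by positivity)
        (fun q hq => by
          have hq2 := (mem_filter.1 hq).2
          calc ∑ i, (q.1 - q.2) i ^ 2 ≤ ∑ _i : Fin n, e ^ 2 := sum_le_sum fun i _ => by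
                have := hq2 i
                rw [← sq_abs]
                exact pow_le_pow_left₀ (abs_nonneg _) this 2
            _ = (√n * e) ^ 2 := by
                rw [mul_pow, Real.sq_sqrt (Nat.cast_nonneg n)]; simp)
        (by
          calc (P.card : ℝ) ≤ ((T (S + 1) ×ˢ T S).card : ℝ) := by
                exact_mod_cast card_filter_le _ _
            _ = (T (S + 1)).card * (T S).card := by rw [card_product]; push_cast; rfl
            _ ≤ Real.exp (A * 4 ^ (S + 1)) * Real.exp (A * 4 ^ S) := by
                gcongr
                · exact hcard _
                · exact hcard _
            _ = Real.exp (A * 4 ^ (S + 1) + A * 4 ^ S) := by rw [Real.exp_add]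
            _ ≤ _ := by
                refine Real.exp_le_exp.2 ?_
                have : (0 : ℝ) < A * 4 ^ S := by positivity
                rw [pow_succ]
                linarith)
      refine ⟨fun σ => M σ + N σ, fun σ w => ?_, ?_⟩
      · have h1 : signSum σ (p (S + 1) w - p S w) ≤ N σ :=
          hN σ (p (S + 1) w, p S w) (mem_filter.2 ⟨mem_product.2 ⟨hpT _ w, hpT _ w⟩, fun i => by
            have h2 := hp (S + 1) w i
            have h3 := hp S w i
            have h4 : E / 2 ^ S = 2 * (E / 2 ^ (S + 1)) := by rw [pow_succ]; field_simp
            have h5 : e = 3 * (E / 2 ^ (S + 1)) := by simp only [e]; ring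
            rw [abs_le] at h2 h3 ⊢
            constructor <;> simp only [] <;> linarith⟩)
        rw [signSum_sub] at h1
        have := hM σ w
        linarith
      · rw [expect_add_distrib]
        -- The root of the entropy grows like `2 ^ S` while the radius shrinks like `2 ^ (-S)`, so
        -- every level costs the same.
        have h6 : √n * e * √(2 * (2 * A * 4 ^ (S + 1))) = 6 * E * √n * √A := by
          have : 2 * (2 * A * 4 ^ (S + 1)) = (2 * 2 ^ (S + 1)) ^ 2 * A := by
            rw [mul_pow, ← pow_mul, mul_comm (S + 1) 2, pow_mul]; norm_num; ring
          rw [this, Real.sqrt_mul (by positivity), Real.sqrt_sq (by positivity)]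
          simp only [e]
          field_simp
          ring
        rw [h6] at hN'
        push_cast
        linarith
  obtain ⟨M, hM, hM'⟩ := key S
  refine ⟨fun σ => n * (E / 2 ^ S) + M σ, fun σ w => ?_, ?_⟩
  · have h1 := signSum_le σ (u := u w - p S w) (hp S w)
    rw [signSum_sub] at h1
    have := hM σ w
    linarith
  · rw [expect_add_distrib, Fintype.expect_const]
    linarith

end SignSum

/-! ### Maurey's lemma by successive choice of atoms. -/

/-- For centred values in `[-c, c]` the exponential moment is at most that of a Gaussian. -/
lemma sum_mul_exp_le {I : Type*} [Fintype I] (q a : I → ℝ) {c : ℝ} (t : ℝ) (hq : ∀ i, 0 ≤ q i)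
    (hq1 : ∑ i, q i = 1) (ha : ∀ i, |a i| ≤ c) (hmean : ∑ i, q i * a i = 0) :
    ∑ i, q i * Real.exp (t * a i) ≤ Real.exp (t ^ 2 * c ^ 2 / 2) := by
  have hI : Nonempty I := by
    by_contra h
    rw [not_nonempty_iff] at h
    simp at hq1
  have hc : 0 ≤ c := (abs_nonneg _).trans (ha hI.some)
  rcases hc.eq_or_lt with rfl | hc
  · have : ∀ i, a i = 0 := fun i => abs_nonpos_iff.1 (ha i)
    simp [this, hq1]
  -- The chord of `exp` over `[-t c, t c]`; its linear term vanishes on averaging.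
  have h1 : ∀ i, Real.exp (t * a i) ≤ Real.cosh (t * c) + a i * (Real.sinh (t * c) / c) := by
    intro i
    have h := abs_le.1 (ha i)
    have hconv := convexOn_exp.2 (Set.mem_univ (t * c)) (Set.mem_univ (-(t * c)))
      (show 0 ≤ (c + a i) / (2 * c) by apply div_nonneg <;> linarith)
      (show 0 ≤ (c - a i) / (2 * c) by apply div_nonneg <;> linarith)
      (by field_simp; ring)
    simp only [smul_eq_mul] at hconv
    have e1 : (c + a i) / (2 * c) * (t * c) + (c - a i) / (2 * c) * -(t * c) = t * a i := by
      field_simp; ring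
    rw [e1] at hconv
    refine hconv.trans (le_of_eq ?_)
    rw [Real.cosh_eq, Real.sinh_eq]
    field_simp
    ring
  calc ∑ i, q i * Real.exp (t * a i)
      ≤ ∑ i, q i * (Real.cosh (t * c) + a i * (Real.sinh (t * c) / c)) :=
        sum_le_sum fun i _ => mul_le_mul_of_nonneg_left (h1 i) (hq i)
    _ = Real.cosh (t * c) * ∑ i, q i + (∑ i, q i * a i) * (Real.sinh (t * c) / c) := by
        rw [mul_sum, sum_mul, ← sum_add_distrib]
        exact sum_congr rfl fun i _ => by ring
    _ = Real.cosh (t * c) := by rw [hq1, hmean]; ring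
    _ ≤ _ := by
        have := Real.cosh_le_exp_half_sq (t * c)
        rwa [mul_pow] at this

lemma exists_le_of_sum_mul_le {I : Type*} [Fintype I] (q f : I → ℝ) {K : ℝ} (hq : ∀ i, 0 ≤ q i)
    (hq1 : ∑ i, q i = 1) (h : ∑ i, q i * f i ≤ K) : ∃ i, f i ≤ K := by
  by_contra! hcon
  have h1 : ∑ i, q i * K < ∑ i, q i * f i := by
    refine sum_lt_sum (fun i _ => mul_le_mul_of_nonneg_left (hcon i).le (hq i)) ?_
    by_contra! h0
    have : ∀ i, q i = 0 := fun i => by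
      by_contra hne
      have := mul_lt_mul_of_pos_left (hcon i) ((hq i).lt_of_ne' hne)
      linarith [h0 i (mem_univ i)]
    simp [this] at hq1
  rw [← sum_mul, hq1] at h1
  linarith

/-- **Maurey's lemma** in the sup norm: averages of `k` atoms approximate a mean at all points of
a finite set simultaneously. -/
lemma exists_small_sums {P I : Type*} [Fintype P] [Fintype I] [Nonempty P] (q : I → ℝ)
    (a : P → I → ℝ) {c : ℝ} (hc : 0 ≤ c) (hq : ∀ i, 0 ≤ q i) (hq1 : ∑ i, q i = 1)
    (ha : ∀ p i, |a p i| ≤ c) (hmean : ∀ p, ∑ i, q i * a p i = 0) (k : ℕ) :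
    ∃ v : Fin k → I, ∀ p, |∑ l, a p (v l)| ≤
      c * √(2 * k * Real.log (2 * Fintype.card P)) := by
  -- Atoms are chosen one at a time. The potential sums both exponential tails over all points;
  -- averaging over the next atom costs a factor at most `K`, so some atom does no worse.
  have step : ∀ (t : ℝ) (k : ℕ), ∃ v : Fin k → I,
      ∑ p, (Real.exp (t * ∑ l, a p (v l)) + Real.exp (-t * ∑ l, a p (v l))) ≤
        2 * Fintype.card P * Real.exp (k * (t ^ 2 * c ^ 2 / 2)) := by
    intro t k
    induction k with
    | zero => exact ⟨Fin.elim0, by simp; linarith⟩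
    | succ k ih =>
      obtain ⟨v, hv⟩ := ih
      set K := Real.exp (t ^ 2 * c ^ 2 / 2)
      obtain ⟨i, hi⟩ := exists_le_of_sum_mul_le q
        (fun i => ∑ p, (Real.exp (t * ∑ l, a p (v l)) * Real.exp (t * a p i) +
          Real.exp (-t * ∑ l, a p (v l)) * Real.exp (-t * a p i)))
        (K := (2 * Fintype.card P * Real.exp (k * (t ^ 2 * c ^ 2 / 2))) * K) hq hq1 (by
          calc _ = ∑ p, (Real.exp (t * ∑ l, a p (v l)) * ∑ i, q i * Real.exp (t * a p i) +
                Real.exp (-t * ∑ l, a p (v l)) * ∑ i, q i * Real.exp (-t * a p i)) := by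
                simp_rw [mul_sum]
                rw [sum_comm]
                refine sum_congr rfl fun p _ => ?_
                rw [← sum_add_distrib]
                exact sum_congr rfl fun i _ => by ring
            _ ≤ ∑ p, (Real.exp (t * ∑ l, a p (v l)) * K +
                Real.exp (-t * ∑ l, a p (v l)) * K) := by
                refine sum_le_sum fun p _ => add_le_add ?_ ?_
                · gcongr
                  exact sum_mul_exp_le q (a p) t hq hq1 (ha p) (hmean p)
                · gcongr
                  have := sum_mul_exp_le q (a p) (-t) hq hq1 (ha p) (hmean p)
                  rwa [neg_sq] at this
            _ = (∑ p, (Real.exp (t * ∑ l, a p (v l)) + Real.exp (-t * ∑ l, a p (v l)))) * K := by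
                rw [sum_mul]
                exact sum_congr rfl fun p _ => by ring
            _ ≤ _ := by gcongr)
      refine ⟨Fin.cons i v, ?_⟩
      simp only [Fin.sum_univ_succ, Fin.cons_zero, Fin.cons_succ]
      calc _ = ∑ p, (Real.exp (t * ∑ l, a p (v l)) * Real.exp (t * a p i) +
          Real.exp (-t * ∑ l, a p (v l)) * Real.exp (-t * a p i)) := by
            refine sum_congr rfl fun p _ => ?_
            rw [← Real.exp_add, ← Real.exp_add]
            congr 2 <;> ring
        _ ≤ _ := hi
        _ = _ := by
            rw [mul_assoc, ← Real.exp_add]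
            congr 2
            push_cast
            ring
  rcases Nat.eq_zero_or_pos k with rfl | hk
  · exact ⟨Fin.elim0, fun p => by simp⟩
  rcases hc.eq_or_lt with rfl | hc
  · have hI : Nonempty I := by
      by_contra h
      rw [not_nonempty_iff] at h
      simp at hq1
    have h0 : ∀ p i, a p i = 0 := fun p i => abs_nonpos_iff.1 (ha p i)
    exact ⟨fun _ => hI.some, fun p => by simp [h0]⟩
  have hk' : (0 : ℝ) < k := by exact_mod_cast hk
  have hcard : (1 : ℝ) ≤ Fintype.card P := by exact_mod_cast Fintype.card_pos
  set Λ := Real.log (2 * Fintype.card P)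
  have hΛ : 0 < Λ := Real.log_pos (by linarith)
  -- Chosen to make both terms of the exponent `Λ + k * (t ^ 2 * c ^ 2 / 2)` equal.
  set t : ℝ := √(2 * Λ / k) / c
  have ht : 0 < t := by positivity
  obtain ⟨v, hv⟩ := step t k
  refine ⟨v, fun p => ?_⟩
  have h1 : Real.exp (t * |∑ l, a p (v l)|) ≤ Real.exp (Λ + k * (t ^ 2 * c ^ 2 / 2)) := by
    rw [Real.exp_add, Real.exp_log (by positivity)]
    refine le_trans ?_ hv
    refine le_trans ?_ (single_le_sum (f := fun p => Real.exp (t * ∑ l, a p (v l)) +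
      Real.exp (-t * ∑ l, a p (v l))) (fun p _ => by positivity) (mem_univ p))
    rcases abs_choice (∑ l, a p (v l)) with h | h <;> rw [h]
    · exact le_add_of_nonneg_right (Real.exp_pos _).le
    · rw [mul_neg, ← neg_mul]
      exact le_add_of_nonneg_left (Real.exp_pos _).le
  have h2 := Real.exp_le_exp.1 h1
  have h3 : t ^ 2 * c ^ 2 = 2 * Λ / k := by
    simp only [t]
    rw [div_pow, Real.sq_sqrt (by positivity)]
    field_simp
  have h4 : t * (c * √(2 * k * Λ)) = 2 * Λ := by
    simp only [t]
    have : √(2 * Λ / k) * √(2 * k * Λ) = 2 * Λ := by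
      rw [← Real.sqrt_mul (by positivity), show 2 * Λ / k * (2 * k * Λ) = (2 * Λ) ^ 2 by
        field_simp, Real.sqrt_sq (by positivity)]
    calc √(2 * Λ / k) / c * (c * √(2 * k * Λ)) = √(2 * Λ / k) * √(2 * k * Λ) := by
          generalize √(2 * Λ / k) = x, √(2 * k * Λ) = y
          field_simp
      _ = 2 * Λ := this
  rw [h3, show k * (2 * Λ / k / 2) = Λ by field_simp] at h2
  refine le_of_mul_le_mul_left ?_ ht
  linarith

/-! ### Sparse approximation in the `ℓ¹` ball. -/

lemma abs_dotProduct_le {d : ℕ} (x w : Fin d → ℝ) {R : ℝ} (hx : ‖x‖ ≤ R) :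
    |x ⬝ᵥ w| ≤ R * ∑ i, |w i| := by
  rw [dotProduct, mul_sum]
  refine (abs_sum_le_sum_abs _ _).trans (sum_le_sum fun i _ => ?_)
  rw [abs_mul]
  exact mul_le_mul_of_nonneg_right ((norm_le_pi_norm x i).trans hx) (abs_nonneg _)

/-- The vertices of the `ℓ¹` ball of radius `W`, together with its centre. -/
noncomputable def l1Atom {d : ℕ} (W : ℝ) : Option (Fin d ⊕ Fin d) → Fin d → ℝ
  | none => 0
  | some (.inl i) => Pi.single i W
  | some (.inr i) => Pi.single i (-W)

/-- The average of a family of `ℓ¹` atoms. -/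
noncomputable def l1Average {d k : ℕ} (W : ℝ) (v : Fin k → Option (Fin d ⊕ Fin d)) : Fin d → ℝ :=
  (1 / (k : ℝ)) • ∑ l, l1Atom W (v l)

lemma sum_abs_l1Atom_le {d : ℕ} {W : ℝ} (hW : 0 ≤ W) (i : Option (Fin d ⊕ Fin d)) :
    ∑ j, |l1Atom W i j| ≤ W := by
  rcases i with _ | i | i
  · simpa [l1Atom] using hW
  · simp [l1Atom, Pi.single_apply, apply_ite, abs_of_nonneg hW]
  · simp [l1Atom, Pi.single_apply, apply_ite, abs_of_nonneg hW]

/-- Averages of `k` atoms approximate all linear functionals of the `ℓ¹` ball at finitely many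
points. -/
lemma exists_l1Average_approx {d : ℕ} {P : Type*} [Fintype P] [Nonempty P] (x : P → Fin d → ℝ)
    {R W : ℝ} (hR : 0 ≤ R) (hW : 0 ≤ W) (hx : ∀ p, ‖x p‖ ≤ R) {w : Fin d → ℝ}
    (hw : w ∈ L1Class d W) {k : ℕ} (hk : 0 < k) :
    ∃ v : Fin k → Option (Fin d ⊕ Fin d), ∀ p,
      |x p ⬝ᵥ w - x p ⬝ᵥ l1Average W v| ≤
        2 * W * R * √(2 * Real.log (2 * Fintype.card P)) / √k := by
  replace hw : ∑ i, |w i| ≤ W := hw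
  have hk' : (0 : ℝ) < k := by exact_mod_cast hk
  have hcancel : ∀ i, |w i| / W * W = |w i| := fun i => by
    rcases hW.eq_or_lt with rfl | hW
    · have := (single_le_sum (f := fun i => |w i|) (fun i _ => abs_nonneg _) (mem_univ i)).trans hw
      simp [le_antisymm this (abs_nonneg _)]
    · field_simp
  -- Barycentric weights of `w`: positive and negative parts go to opposite vertices, and the centre
  -- absorbs the slack. For `W = 0`, division by zero puts all the mass on the centre.
  let q : Option (Fin d ⊕ Fin d) → ℝ
    | none => 1 - ∑ i, |w i| / W
    | some (.inl i) => max (w i) 0 / W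
    | some (.inr i) => max (-w i) 0 / W
  have hparts : ∀ i, max (w i) 0 + max (-w i) 0 = |w i| := fun i => by
    rcases le_total 0 (w i) with h | h
    · rw [max_eq_left h, max_eq_right (by linarith), abs_of_nonneg h, add_zero]
    · rw [max_eq_right h, max_eq_left (by linarith), abs_of_nonpos h, zero_add]
  have hparts' : ∀ i, max (w i) 0 - max (-w i) 0 = w i := fun i => by
    rcases le_total 0 (w i) with h | h
    · rw [max_eq_left h, max_eq_right (by linarith), sub_zero]
    · rw [max_eq_right h, max_eq_left (by linarith)]; ring
  have hq : ∀ i, 0 ≤ q i := by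
    rintro (_ | i | i)
    · simp only [q]
      rw [← sum_div, sub_nonneg]
      exact div_le_one_of_le₀ hw hW
    · exact div_nonneg (le_max_right _ _) hW
    · exact div_nonneg (le_max_right _ _) hW
  have hq1 : ∑ i, q i = 1 := by
    rw [Fintype.sum_option, Fintype.sum_sum_type]
    simp only [q]
    rw [← sum_add_distrib]
    simp_rw [← add_div, hparts]
    ring
  have hmean : ∀ p, ∑ i, q i * (x p ⬝ᵥ l1Atom W i) = x p ⬝ᵥ w := fun p => by
    rw [Fintype.sum_option, Fintype.sum_sum_type]
    simp only [q, l1Atom, dotProduct_zero, mul_zero, zero_add, dotProduct_single]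
    rw [← sum_add_distrib, dotProduct]
    refine sum_congr rfl fun i _ => ?_
    have h1 : (max (w i) 0 - max (-w i) 0) / W * W = w i := by
      rw [hparts']
      rcases eq_or_ne W 0 with rfl | h
      · have := hcancel i
        simp only [mul_zero] at this ⊢
        exact (abs_eq_zero.1 this.symm).symm
      · field_simp
    calc _ = x p i * ((max (w i) 0 - max (-w i) 0) / W * W) := by ring
      _ = _ := by rw [h1]
  obtain ⟨v, hv⟩ := exists_small_sums q (fun p i => x p ⬝ᵥ l1Atom W i - x p ⬝ᵥ w)
    -- Both the atom's value and the mean lie in `[-W R, W R]`.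
    (c := 2 * W * R) (by positivity) hq hq1
    (fun p i => by
      have h1 := abs_dotProduct_le (x p) w (hx p)
      have h2 := abs_dotProduct_le (x p) (l1Atom W i) (hx p)
      have h3 := mul_le_mul_of_nonneg_left hw hR
      have h4 := mul_le_mul_of_nonneg_left (sum_abs_l1Atom_le hW i) hR
      have h5 := abs_sub (x p ⬝ᵥ l1Atom W i) (x p ⬝ᵥ w)
      linarith)
    (fun p => by
      simp_rw [mul_sub]
      rw [sum_sub_distrib, hmean, ← sum_mul, hq1]
      ring) k
  refine ⟨v, fun p => ?_⟩
  have h1 : x p ⬝ᵥ w - x p ⬝ᵥ l1Average W v =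
      -((1 / k) * ∑ l, (x p ⬝ᵥ l1Atom W (v l) - x p ⬝ᵥ w)) := by
    rw [l1Average, dotProduct_smul, dotProduct_sum, sum_sub_distrib]
    simp
    field_simp
    ring
  rw [h1, abs_neg, abs_mul, abs_of_nonneg (by positivity : (0 : ℝ) ≤ 1 / k), one_div,
    ← div_eq_inv_mul, div_le_iff₀ hk']
  refine (hv p).trans (le_of_eq ?_)
  have h2 : √(2 * k * Real.log (2 * Fintype.card P)) =
      √k * √(2 * Real.log (2 * Fintype.card P)) := by
    rw [← Real.sqrt_mul hk'.le]
    congr 1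
    ring
  rw [h2]
  nth_rewrite 3 [← Real.mul_self_sqrt hk'.le]
  have : √(k : ℝ) ≠ 0 := (Real.sqrt_pos.2 hk').ne'
  field_simp

/-! ### Rademacher complexity of the loss class. -/

section Loss

variable {m d : ℕ} {G W R : ℝ} {Y : Set (Fin m → ℝ)} {φ : (Fin m → ℝ) → Y → ℝ}

lemma abs_exampleLoss_sub_le (hG : 0 ≤ G) (hφ : IsLipschitzLoss φ G) (w w' : Fin d → ℝ)
    (z : Example m d R Y) {e : ℝ} (he : 0 ≤ e)
    (h : ∀ j, |z.1.1 j ⬝ᵥ w - z.1.1 j ⬝ᵥ w'| ≤ e) :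
    |exampleLoss φ w z - exampleLoss φ w' z| ≤ G * e :=
  (hφ z.2 _ _).trans (mul_le_mul_of_nonneg_left ((pi_norm_le_iff_of_nonneg he).2 h) hG)

lemma exists_majorant_exampleLoss_chaining {n : ℕ} (hm : 1 ≤ m) (hn : 1 ≤ n) (hd : 1 ≤ d)
    (hG : 0 ≤ G) (hW : 0 ≤ W) (hR : 0 ≤ R) (hφ : IsLipschitzLoss φ G)
    (z : Fin n → Example m d R Y) (S : ℕ) :
    ∃ M : (Fin n → ℤˣ) → ℝ,
      (∀ σ, ∀ w : L1Class d W, signSum σ (fun i => exampleLoss φ w (z i)) ≤ M σ) ∧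
      𝔼 σ, M σ ≤ n * ((4 * G * W * R * √(2 * Real.log (2 * (n * m)))) / 2 ^ S) +
        S * (6 * (4 * G * W * R * √(2 * Real.log (2 * (n * m)))) * √n *
          √(Real.log (2 * d + 1))) := by
  classical
  have : Nonempty (Fin n × Fin m) := ⟨⟨0, hn⟩, ⟨0, hm⟩⟩
  have hn1 : (1 : ℝ) ≤ n := by exact_mod_cast hn
  have hm1 : (1 : ℝ) ≤ m := by exact_mod_cast hm
  have hd1 : (1 : ℝ) ≤ d := by exact_mod_cast hd
  have hnm : (1 : ℝ) ≤ n * m := one_le_mul_of_one_le_of_one_le hn1 hm1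
  -- The 4 is the 2 of Maurey's bound times a 2 from the index shift: level `s + 1` uses `4 ^ s`
  -- atoms.
  set E : ℝ := 4 * G * W * R * √(2 * Real.log (2 * (n * m)))
  have hE : 0 ≤ E := by positivity
  let F : (Fin d → ℝ) → Fin n → ℝ := fun w i => exampleLoss φ w (z i)
  let T : ℕ → Finset (Fin n → ℝ)
    | 0 => {F 0}
    | s + 1 => univ.image fun v : Fin (4 ^ s) → Option (Fin d ⊕ Fin d) => F (l1Average W v)
  refine exists_majorant_of_nets (fun w : L1Class d W => F w) T (F 0)
    (Real.log_pos (by linarith)) hE rfl (fun s => ?_) (fun s w => ?_) S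
  · cases s with
    | zero =>
      have : (0 : ℝ) ≤ Real.log (2 * d + 1) := Real.log_nonneg (by linarith)
      simpa [T] using Real.one_le_exp this
    | succ s =>
      have h1 : (T (s + 1)).card ≤ (2 * d + 1) ^ 4 ^ s := by
        refine card_image_le.trans (le_of_eq ?_)
        simp [two_mul]
      calc ((T (s + 1)).card : ℝ) ≤ (2 * d + 1 : ℝ) ^ 4 ^ s := by exact_mod_cast h1
        _ = Real.exp (Real.log (2 * d + 1) * 4 ^ s) := by
            rw [mul_comm (Real.log _), ← Real.exp_log (show (0 : ℝ) < 2 * d + 1 by positivity),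
              ← Real.exp_nat_mul, Real.log_exp]
            push_cast
            rfl
        _ ≤ _ := by
            have : (0 : ℝ) ≤ Real.log (2 * d + 1) := Real.log_nonneg (by linarith)
            gcongr
            · norm_num
            · omega
  · cases s with
    | zero =>
      refine ⟨F 0, by simp [T], fun i => ?_⟩
      have h1 : |F w i - F 0 i| ≤ G * (R * W) :=
        abs_exampleLoss_sub_le hG hφ _ _ _ (by positivity) fun j => by
          rw [dotProduct_zero, sub_zero]
          exact (abs_dotProduct_le _ _ ((z i).1.2 j)).trans (mul_le_mul_of_nonneg_left w.2 hR)
      refine h1.trans ?_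
      -- Level 0 has only the crude radius `G * R * W`; it is below `E` because `2 * log 2 ≥ 1`.
      have h2 : (1 : ℝ) ≤ √(2 * Real.log (2 * (n * m))) := by
        rw [Real.one_le_sqrt]
        have := Real.log_le_log (by norm_num) (show (2 : ℝ) ≤ 2 * (n * m) by linarith)
        linarith [Real.log_two_gt_d9]
      have h3 : (0 : ℝ) ≤ G * W * R := by positivity
      simp only [E, pow_zero, div_one]
      nlinarith
    | succ s =>
      obtain ⟨v, hv⟩ := exists_l1Average_approx (fun p : Fin n × Fin m => (z p.1).1.1 p.2) hR hW
        (fun p => (z p.1).1.2 p.2) w.2 (k := 4 ^ s) (by positivity)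
      refine ⟨F (l1Average W v), mem_image.2 ⟨v, mem_univ _, rfl⟩, fun i => ?_⟩
      refine (abs_exampleLoss_sub_le hG hφ _ _ _ (by positivity) fun j => hv (i, j)).trans
        (le_of_eq ?_)
      have h4 : √((4 ^ s : ℕ) : ℝ) = 2 ^ s := by
        rw [show ((4 ^ s : ℕ) : ℝ) = (2 ^ s) ^ 2 by
          push_cast; rw [← pow_mul, mul_comm, pow_mul]; norm_num]
        exact Real.sqrt_sq (by positivity)
      rw [h4]
      simp only [E, Fintype.card_prod, Fintype.card_fin, pow_succ]
      push_cast
      field_simp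
      ring

/-- The empirical Rademacher complexity bound for the loss class. -/
lemma exists_majorant_exampleLoss {n : ℕ} (hm : 1 ≤ m) (hn : 1 ≤ n) (hd : 2 ≤ d)
    (hG : 0 ≤ G) (hW : 0 ≤ W) (hR : 0 ≤ R) (hφ : IsLipschitzLoss φ G)
    (z : Fin n → Example m d R Y) :
    ∃ M : (Fin n → ℤˣ) → ℝ,
      (∀ σ, ∀ w : L1Class d W, signSum σ (fun i => exampleLoss φ w (z i)) ≤ M σ) ∧
      𝔼 σ, M σ ≤ 112 * (1 + Real.log (m * n)) ^ 2 * (G * W * R * (√n * √(Real.log d))) := by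
  -- The first level with `4 ^ S > n`: the residual `n * E / 2 ^ S` is then at most `√n * E`.
  obtain ⟨M, hM, hM'⟩ := exists_majorant_exampleLoss_chaining (W := W) hm hn (by omega) hG hW hR hφ z
    (Nat.log 4 n + 1)
  refine ⟨M, hM, hM'.trans ?_⟩
  have hn1 : (1 : ℝ) ≤ n := by exact_mod_cast hn
  have hm1 : (1 : ℝ) ≤ m := by exact_mod_cast hm
  have hd2 : (2 : ℝ) ≤ d := by exact_mod_cast hd
  have hnm : (1 : ℝ) ≤ m * n := one_le_mul_of_one_le_of_one_le hm1 hn1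
  set ℓ : ℝ := Real.log (m * n)
  have hℓ : 0 ≤ ℓ := Real.log_nonneg hnm
  have hl2 : Real.log 2 < 1 := by linarith [Real.log_two_lt_d9]
  have hE : √(2 * Real.log (2 * (n * m))) ≤ 2 * (1 + ℓ) := by
    rw [mul_comm (n : ℝ) m, Real.log_mul (by norm_num) (by positivity)]
    refine Real.sqrt_le_iff.2 ⟨by positivity, ?_⟩
    change 2 * (Real.log 2 + ℓ) ≤ _
    nlinarith
  -- Since `d ≥ 2`, one has `2 * d + 1 ≤ d ^ 4`.
  have hA : √(Real.log (2 * d + 1)) ≤ 2 * √(Real.log d) := by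
    rw [show (2 : ℝ) = √4 by rw [show (4 : ℝ) = 2 ^ 2 by norm_num]; simp,
      ← Real.sqrt_mul (by norm_num)]
    refine Real.sqrt_le_sqrt ?_
    rw [show √4 = (2 : ℝ) by rw [show (4 : ℝ) = 2 ^ 2 by norm_num]; simp]
    rw [show (4 : ℝ) * Real.log d = Real.log (d ^ 4) by rw [Real.log_pow]; norm_num]
    refine Real.log_le_log (by positivity) ?_
    nlinarith [pow_le_pow_left₀ (by norm_num) hd2 3]
  have hA1 : (1 : ℝ) ≤ √(Real.log (2 * d + 1)) := by
    rw [Real.one_le_sqrt, Real.le_log_iff_exp_le (by positivity)]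
    linarith [Real.exp_one_lt_d9]
  have hS : ((Nat.log 4 n + 1 : ℕ) : ℝ) ≤ 1 + ℓ := by
    have h1 : ((4 : ℝ)) ^ Nat.log 4 n ≤ m * n := by
      have : ((4 : ℝ)) ^ Nat.log 4 n ≤ n := by exact_mod_cast Nat.pow_log_le_self 4 (by omega)
      nlinarith
    have h2 := Real.log_le_log (by positivity) h1
    rw [Real.log_pow] at h2
    have h3 : (1 : ℝ) ≤ Real.log 4 := by
      rw [Real.le_log_iff_exp_le (by norm_num)]
      linarith [Real.exp_one_lt_d9]
    push_cast
    have h4 : (0 : ℝ) ≤ (Nat.log 4 n : ℝ) := Nat.cast_nonneg _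
    have h5 : (Nat.log 4 n : ℝ) ≤ ℓ := by
      change _ ≤ ℓ at h2
      nlinarith
    linarith
  have hpow : (n : ℝ) / 2 ^ (Nat.log 4 n + 1) ≤ √n := by
    rw [div_le_iff₀ (by positivity)]
    have h1 : √(n : ℝ) ≤ 2 ^ (Nat.log 4 n + 1) := by
      refine Real.sqrt_le_iff.2 ⟨by positivity, ?_⟩
      rw [← pow_mul, mul_comm, pow_mul]
      norm_num
      exact_mod_cast (Nat.lt_pow_succ_log_self (by norm_num) n).le
    calc (n : ℝ) = √n * √n := (Real.mul_self_sqrt (by positivity)).symm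
      _ ≤ _ := by gcongr
  set Q := √(Real.log (2 * d + 1))
  set U := √(2 * Real.log (2 * (n * m)))
  set S : ℝ := ((Nat.log 4 n + 1 : ℕ) : ℝ)
  calc n * (4 * G * W * R * U / 2 ^ (Nat.log 4 n + 1)) + S * (6 * (4 * G * W * R * U) * √n * Q)
      = 4 * G * W * R * U * (n / 2 ^ (Nat.log 4 n + 1) + S * 6 * √n * Q) := by ring
    -- One factor `1 + ℓ` comes from Maurey's bound, the other from the number of levels; `4 * 2 *
    -- (1 + 6) = 56`.
    _ ≤ 4 * G * W * R * (2 * (1 + ℓ)) * ((1 + ℓ) * √n * Q + (1 + ℓ) * 6 * √n * Q) := by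
        gcongr
        calc _ ≤ √(n : ℝ) := hpow
          _ = 1 * √(n : ℝ) * 1 := by ring
          _ ≤ _ := by
            gcongr
            linarith
    _ = 56 * (1 + ℓ) ^ 2 * (G * W * R * √n * Q) := by ring
    _ ≤ 56 * (1 + ℓ) ^ 2 * (G * W * R * √n * (2 * √(Real.log d))) := by gcongr
    _ = _ := by ring

end Loss

/-! ### Bounded differences. -/

lemma integrable_of_abs_le {α : Type*} [MeasurableSpace α] {μ : Measure α} [IsFiniteMeasure μ]
    {f : α → ℝ} {K : ℝ} (hf : Measurable f) (hK : ∀ x, |f x| ≤ K) : Integrable f μ :=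
  Integrable.of_bound hf.aestronglyMeasurable K (Filter.Eventually.of_forall hK)

lemma abs_integral_sub_le {α : Type*} [MeasurableSpace α] {μ : Measure α}
    [IsProbabilityMeasure μ] {f g : α → ℝ} {c : ℝ} (hf : Integrable f μ) (hg : Integrable g μ)
    (h : ∀ x, |f x - g x| ≤ c) : |∫ x, f x ∂μ - ∫ x, g x ∂μ| ≤ c := by
  rw [← integral_sub hf hg]
  simpa using norm_integral_le_of_norm_le_const (μ := μ) (f := fun x => f x - g x)
    (Filter.Eventually.of_forall h)

lemma abs_ciSup_sub_ciSup_le {ι : Type*} [Nonempty ι] {f g : ι → ℝ} {c : ℝ}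
    (hf : BddAbove (Set.range f)) (hg : BddAbove (Set.range g)) (h : ∀ k, |f k - g k| ≤ c) :
    |(⨆ k, f k) - ⨆ k, g k| ≤ c := by
  rw [abs_le]
  constructor
  · have : ⨆ k, g k ≤ (⨆ k, f k) + c := ciSup_le fun k => by
      have h1 := (abs_le.1 (h k)).1
      have h2 := le_ciSup hf k
      linarith
    linarith
  · have : ⨆ k, f k ≤ (⨆ k, g k) + c := ciSup_le fun k => by
      have h1 := (abs_le.1 (h k)).2
      have h2 := le_ciSup hg k
      linarith
    linarith

section BoundedDifferences

variable {Z : Type*} [MeasurableSpace Z] (D : Measure Z) [IsProbabilityMeasure D]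

lemma measurable_finCons (n : ℕ) :
    Measurable fun x : Z × (Fin n → Z) => (Fin.cons x.1 x.2 : Fin (n + 1) → Z) :=
  measurable_pi_iff.2 <| Fin.cases (by simpa using measurable_fst) fun i => by
    simpa using! (measurable_pi_apply i).comp measurable_snd

lemma integral_pi_finSucc {n : ℕ} {f : (Fin (n + 1) → Z) → ℝ}
    (hf : Integrable f (Measure.pi fun _ => D)) :
    ∫ S, f S ∂(Measure.pi fun _ => D) =
      ∫ z, ∫ S, f (Fin.cons z S) ∂(Measure.pi fun _ : Fin n => D) ∂D := by
  have mp := (measurePreserving_piFinSuccAbove (fun _ : Fin (n + 1) => D) 0).symm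
  have he : ∀ x : Z × (Fin n → Z),
      (MeasurableEquiv.piFinSuccAbove (fun _ : Fin (n + 1) => Z) 0).symm x =
        Fin.cons x.1 x.2 := fun x => by
    simp [MeasurableEquiv.piFinSuccAbove, Fin.insertNthEquiv]
  have h1 := mp.integral_comp' f
  have h2 := (mp.integrable_comp_emb (MeasurableEquiv.measurableEmbedding _)).2 hf
  simp only [Function.comp_def, he] at h1 h2
  rw [← h1, integral_prod _ h2]

/-- The exponential moment form of **McDiarmid's inequality**. -/
lemma integral_exp_le_of_bounded_differences {c K : ℝ} (t : ℝ) (n : ℕ)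
    (g : (Fin n → Z) → ℝ) (hg : Measurable g) (hK : ∀ S, |g S| ≤ K)
    (hdiff : ∀ S i z, |g (Function.update S i z) - g S| ≤ c) :
    ∫ S, Real.exp (t * (g S - ∫ S', g S' ∂(Measure.pi fun _ => D)))
      ∂(Measure.pi fun _ : Fin n => D) ≤ Real.exp (n * (t ^ 2 * c ^ 2 / 2)) := by
  induction n with
  | zero =>
    have : ∀ S, g S = g default := fun S => congrArg g (Subsingleton.elim _ _)
    simp [this]
  | succ n ih =>
    have hZ : Nonempty Z := nonempty_of_isProbabilityMeasure D
    set P := Measure.pi fun _ : Fin n => D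
    -- `g - E g` splits into the increment `gbar z - E g` and the fluctuation of the section at `z`,
    -- to which the induction hypothesis applies.
    set gbar : Z → ℝ := fun z => ∫ S, g (Fin.cons z S) ∂P
    have hmeas : Measurable fun x : Z × (Fin n → Z) => g (Fin.cons x.1 x.2) :=
      hg.comp (measurable_finCons n)
    have hmeas1 : ∀ z, Measurable fun S : Fin n → Z => g (Fin.cons z S) := fun z =>
      hmeas.comp (measurable_const.prodMk measurable_id)
    have hint : ∀ z, Integrable (fun S : Fin n → Z => g (Fin.cons z S)) P := fun z =>
      integrable_of_abs_le (hmeas1 z) fun S => hK _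
    have hgm : Measurable gbar :=
      (hmeas.stronglyMeasurable.integral_prod_right (ν := P)).measurable
    have hgd : ∀ z z', |gbar z - gbar z'| ≤ c := fun z z' =>
      abs_integral_sub_le (hint z) (hint z') fun S => by
        have := hdiff (Fin.cons z' S) 0 z
        rwa [Fin.update_cons_zero] at this
    have hgb : ∀ z, |gbar z| ≤ K := fun z => by
      have := abs_integral_sub_le (c := K) (hint z) (integrable_zero _ ℝ P) fun S => by
        simpa using hK _
      simpa using this
    have hEg : ∫ S, g S ∂(Measure.pi fun _ => D) = ∫ z, gbar z ∂D :=
      integral_pi_finSucc D (integrable_of_abs_le hg hK)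
    rw [hEg]
    set Eg := ∫ z, gbar z ∂D
    have hgc : ∀ z, |gbar z - Eg| ≤ c := fun z => by
      have := abs_integral_sub_le (c := c) (μ := D) (integrable_const (gbar z))
        (integrable_of_abs_le hgm hgb) fun z' => hgd z z'
      simpa using this
    have hexp : Integrable (fun S => Real.exp (t * (g S - Eg)))
        (Measure.pi fun _ : Fin (n + 1) => D) := by
      refine integrable_of_abs_le (K := Real.exp (|t| * (K + |Eg|))) (by fun_prop) fun S => ?_
      rw [abs_of_pos (Real.exp_pos _), Real.exp_le_exp]
      refine (le_abs_self _).trans ?_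
      rw [abs_mul]
      exact mul_le_mul_of_nonneg_left ((abs_sub _ _).trans (add_le_add (hK S) le_rfl))
        (abs_nonneg t)
    rw [integral_pi_finSucc D hexp]
    -- The increment is placed in `[-c, c]`, giving variance proxy `c ^ 2`; an interval of length
    -- `c` would give the sharper `c ^ 2 / 4`.
    have hsub := ProbabilityTheory.hasSubgaussianMGF_of_mem_Icc_of_integral_eq_zero (μ := D)
      (X := fun z => gbar z - Eg) (a := -c) (b := c) (hgm.sub_const _).aemeasurable
      (Filter.Eventually.of_forall fun z => abs_le.1 (hgc z))
      (by
        rw [integral_sub (integrable_of_abs_le hgm hgb) (integrable_const _)]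
        simp [Eg])
    calc ∫ z, ∫ S, Real.exp (t * (g (Fin.cons z S) - Eg)) ∂P ∂D
        ≤ ∫ z, Real.exp (n * (t ^ 2 * c ^ 2 / 2)) * Real.exp (t * (gbar z - Eg)) ∂D := by
          refine integral_mono_of_nonneg
            (Filter.Eventually.of_forall fun z => integral_nonneg fun S => (Real.exp_pos _).le)
            ((hsub.integrable_exp_mul t).const_mul _) (Filter.Eventually.of_forall fun z => ?_)
          have h1 : ∀ S : Fin n → Z, Real.exp (t * (g (Fin.cons z S) - Eg)) =
              Real.exp (t * (g (Fin.cons z S) - gbar z)) * Real.exp (t * (gbar z - Eg)) :=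
            fun S => by rw [← Real.exp_add]; congr 1; ring
          simp only [h1]
          rw [integral_mul_const]
          refine mul_le_mul_of_nonneg_right ?_ (Real.exp_pos _).le
          refine ih (fun S => g (Fin.cons z S)) (hmeas1 z) (fun S => hK _) fun S i z' => ?_
          have := hdiff (Fin.cons z S) i.succ z'
          rwa [← Fin.cons_update] at this
      _ = Real.exp (n * (t ^ 2 * c ^ 2 / 2)) * ∫ z, Real.exp (t * (gbar z - Eg)) ∂D :=
          integral_const_mul _ _
      _ ≤ Real.exp (n * (t ^ 2 * c ^ 2 / 2)) * Real.exp (t ^ 2 * c ^ 2 / 2) := by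
          gcongr
          refine (hsub.mgf_le t).trans (le_of_eq ?_)
          congr 1
          have : ((‖c - -c‖₊ / 2) ^ 2 : NNReal) = (c ^ 2 : ℝ) := by
            push_cast
            rw [Real.norm_eq_abs, div_pow, sq_abs]
            ring
          rw [this]
          ring
      _ = _ := by
          rw [← Real.exp_add]
          congr 1
          push_cast
          ring

/-- **McDiarmid's inequality**, upper tail at confidence level `1 - δ`. -/
lemma bounded_differences_upper_tail {c K δ : ℝ} (hc : 0 < c) (hδ : 0 < δ) (hδ1 : δ < 1) {n : ℕ}
    (hn : 1 ≤ n) (g : (Fin n → Z) → ℝ) (hg : Measurable g) (hK : ∀ S, |g S| ≤ K)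
    (hdiff : ∀ S i z, |g (Function.update S i z) - g S| ≤ c) :
    HoldsWithProbAtLeast (Measure.pi fun _ : Fin n => D) (1 - δ) fun S =>
      g S ≤ ∫ S', g S' ∂(Measure.pi fun _ : Fin n => D) + c * √(2 * n * Real.log (1 / δ)) := by
  set P := Measure.pi fun _ : Fin n => D
  set Eg := ∫ S', g S' ∂P
  have hn' : (0 : ℝ) < n := by exact_mod_cast hn
  set Λ := Real.log (1 / δ)
  have hΛ : 0 < Λ := Real.log_pos (by rw [lt_div_iff₀ hδ]; linarith)
  set ε : ℝ := c * √(2 * n * Λ)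
  have hε2 : ε ^ 2 = c ^ 2 * (2 * n * Λ) := by
    simp only [ε]
    rw [mul_pow, Real.sq_sqrt (by positivity)]
  have hε : 0 < ε := by positivity
  -- The minimizer of `-t * ε + n * t ^ 2 * c ^ 2 / 2`.
  set t : ℝ := ε / (n * c ^ 2)
  have ht : 0 ≤ t := by positivity
  have hint : Integrable (fun S => Real.exp (t * (g S - Eg))) P := by
    refine integrable_of_abs_le (K := Real.exp (|t| * (K + |Eg|))) (by fun_prop) fun S => ?_
    rw [abs_of_pos (Real.exp_pos _), Real.exp_le_exp]
    refine (le_abs_self _).trans ?_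
    rw [abs_mul]
    exact mul_le_mul_of_nonneg_left ((abs_sub _ _).trans (add_le_add (hK S) le_rfl))
      (abs_nonneg t)
  have htail := ProbabilityTheory.measure_ge_le_exp_mul_mgf (μ := P)
    (X := fun S => g S - Eg) ε ht hint
  have hδ' : P.real {S | ε ≤ g S - Eg} ≤ δ := by
    refine htail.trans ?_
    have h1 := integral_exp_le_of_bounded_differences D t n g hg hK hdiff
    have h2 : -t * ε + n * (t ^ 2 * c ^ 2 / 2) = -Λ := by
      have e1 : t * ε = 2 * Λ := by
        simp only [t]
        rw [div_mul_eq_mul_div, ← sq, hε2]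
        field_simp
      have e2 : n * (t ^ 2 * c ^ 2 / 2) = t * ε / 2 := by
        simp only [t]
        field_simp
      rw [e2]
      linarith
    calc _ ≤ Real.exp (-t * ε) * Real.exp (n * (t ^ 2 * c ^ 2 / 2)) := by
          gcongr
          exact h1
      _ = Real.exp (-Λ) := by rw [← Real.exp_add, h2]
      _ = δ := by simp [Λ, Real.exp_log hδ]
  have hE : MeasurableSet {S | ε ≤ g S - Eg} := measurableSet_le measurable_const (hg.sub_const _)
  refine ⟨{S | ε ≤ g S - Eg}ᶜ, hE.compl, ?_, fun S hS => ?_⟩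
  · rw [← ENNReal.ofReal_toReal (measure_ne_top P {S | ε ≤ g S - Eg}ᶜ)]
    refine ENNReal.ofReal_le_ofReal ?_
    change 1 - δ ≤ P.real _
    rw [probReal_compl_eq_one_sub hE]
    linarith
  · have : ¬ ε ≤ g S - Eg := hS
    linarith

end BoundedDifferences

/-! ### Symmetrization and uniform deviations. -/

section Symmetrization

variable {Z ι : Type*} {n : ℕ} {f : ι → Z → ℝ} {B : ℝ}

/-- The symmetrized deviation of a sample of pairs. -/
noncomputable def symmDev (f : ι → Z → ℝ) (σ : Fin n → ℤˣ) (T : Fin n → Z × Z) : ℝ :=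
  ⨆ k, signSum σ fun i => f k (T i).2 - f k (T i).1

/-- `n` times the largest excess of an expectation over its empirical mean. -/
noncomputable def supDev [MeasurableSpace Z] (D : Measure Z) (f : ι → Z → ℝ) (S : Fin n → Z) : ℝ :=
  ⨆ k, (n * ∫ z, f k z ∂D - ∑ i, f k (S i))

lemma measurable_signSum {α : Type*} [MeasurableSpace α] (σ : Fin n → ℤˣ) {u : α → Fin n → ℝ}
    (hu : ∀ i, Measurable fun x => u x i) : Measurable fun x => signSum σ (u x) := by
  unfold signSum
  fun_prop

lemma signSum_diff_le (h0 : ∀ k z, 0 ≤ f k z) (hB : ∀ k z, f k z ≤ B) (σ : Fin n → ℤˣ)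
    (T : Fin n → Z × Z) (k : ι) :
    |signSum σ fun i => f k (T i).2 - f k (T i).1| ≤ n * B := by
  have h : ∀ i, |f k (T i).2 - f k (T i).1| ≤ B := fun i => by
    rw [abs_le]
    constructor <;> linarith [h0 k (T i).2, h0 k (T i).1, hB k (T i).2, hB k (T i).1]
  rw [abs_le]
  refine ⟨?_, signSum_le σ h⟩
  have := signSum_le (-σ) h
  rw [signSum_neg] at this
  linarith

lemma bddAbove_signSum_diff (h0 : ∀ k z, 0 ≤ f k z) (hB : ∀ k z, f k z ≤ B) (σ : Fin n → ℤˣ)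
    (T : Fin n → Z × Z) :
    BddAbove (Set.range fun k => signSum σ fun i => f k (T i).2 - f k (T i).1) :=
  ⟨n * B, by
    rintro _ ⟨k, rfl⟩
    exact (abs_le.1 (signSum_diff_le h0 hB σ T k)).2⟩

lemma abs_symmDev_le [Nonempty ι] (h0 : ∀ k z, 0 ≤ f k z) (hB : ∀ k z, f k z ≤ B) (σ : Fin n → ℤˣ)
    (T : Fin n → Z × Z) : |symmDev f σ T| ≤ n * B := by
  rw [abs_le]
  refine ⟨?_, ciSup_le fun k => (abs_le.1 (signSum_diff_le h0 hB σ T k)).2⟩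
  exact (abs_le.1 (signSum_diff_le h0 hB σ T (Classical.arbitrary ι))).1.trans
    (le_ciSup (bddAbove_signSum_diff h0 hB σ T) _)

lemma measurable_symmDev [MeasurableSpace Z] [Countable ι] (hf : ∀ k, Measurable (f k)) (σ : Fin n → ℤˣ) :
    Measurable (symmDev f σ) :=
  Measurable.iSup fun k => measurable_signSum σ fun i => by
    have := hf k
    fun_prop

lemma measurable_supDev [MeasurableSpace Z] [Countable ι] (D : Measure Z) (hf : ∀ k, Measurable (f k)) :
    Measurable (supDev D f : (Fin n → Z) → ℝ) :=
  Measurable.iSup fun k => by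
    have := hf k
    fun_prop

lemma abs_sum_update_sub_le {g : Z → ℝ} (h0 : ∀ z, 0 ≤ g z) (hB : ∀ z, g z ≤ B)
    (S : Fin n → Z) (i : Fin n) (z : Z) :
    |∑ j, g (Function.update S i z j) - ∑ j, g (S j)| ≤ B := by
  have h1 : ∑ j, g (Function.update S i z j) - ∑ j, g (S j) = g z - g (S i) := by
    rw [← sum_sub_distrib, sum_eq_single i]
    · simp
    · intro j _ hj
      simp [Function.update_of_ne hj]
    · simp
  rw [h1, abs_le]
  constructor <;> linarith [h0 z, hB z, h0 (S i), hB (S i)]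

variable [MeasurableSpace Z] (D : Measure Z) [IsProbabilityMeasure D]

lemma integral_mem_Icc (hf : ∀ k, Measurable (f k)) (h0 : ∀ k z, 0 ≤ f k z)
    (hB : ∀ k z, f k z ≤ B) (k : ι) : 0 ≤ ∫ z, f k z ∂D ∧ ∫ z, f k z ∂D ≤ B := by
  refine ⟨integral_nonneg (h0 k), ?_⟩
  have := integral_mono (μ := D) (integrable_of_abs_le (K := B) (hf k) fun z => by
    rw [abs_of_nonneg (h0 k z)]; exact hB k z) (integrable_const B) (hB k)
  simpa using this

lemma abs_deviation_le (hf : ∀ k, Measurable (f k)) (h0 : ∀ k z, 0 ≤ f k z)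
    (hB : ∀ k z, f k z ≤ B) (S : Fin n → Z) (k : ι) :
    |n * ∫ z, f k z ∂D - ∑ i, f k (S i)| ≤ n * B := by
  obtain ⟨h1, h2⟩ := integral_mem_Icc D hf h0 hB k
  have h3 : ∑ i, f k (S i) ≤ n * B := by
    simpa using sum_le_sum fun i (_ : i ∈ univ) => hB k (S i)
  have h4 : 0 ≤ ∑ i, f k (S i) := sum_nonneg fun i _ => h0 k _
  have h5 : n * ∫ z, f k z ∂D ≤ n * B := mul_le_mul_of_nonneg_left h2 (Nat.cast_nonneg n)
  have h6 : 0 ≤ n * ∫ z, f k z ∂D := mul_nonneg (Nat.cast_nonneg n) h1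
  rw [abs_le]
  constructor <;> linarith

lemma bddAbove_deviation (hf : ∀ k, Measurable (f k)) (h0 : ∀ k z, 0 ≤ f k z)
    (hB : ∀ k z, f k z ≤ B) (S : Fin n → Z) :
    BddAbove (Set.range fun k => n * ∫ z, f k z ∂D - ∑ i, f k (S i)) :=
  ⟨n * B, by
    rintro _ ⟨k, rfl⟩
    exact (abs_le.1 (abs_deviation_le D hf h0 hB S k)).2⟩

lemma abs_supDev_le [Nonempty ι] (hf : ∀ k, Measurable (f k)) (h0 : ∀ k z, 0 ≤ f k z)
    (hB : ∀ k z, f k z ≤ B) (S : Fin n → Z) : |supDev D f S| ≤ n * B := by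
  rw [abs_le]
  refine ⟨?_, ciSup_le fun k => (abs_le.1 (abs_deviation_le D hf h0 hB S k)).2⟩
  exact (abs_le.1 (abs_deviation_le D hf h0 hB S (Classical.arbitrary ι))).1.trans
    (le_ciSup (bddAbove_deviation D hf h0 hB S) _)

lemma abs_supDev_update_sub_le [Nonempty ι] (hf : ∀ k, Measurable (f k)) (h0 : ∀ k z, 0 ≤ f k z)
    (hB : ∀ k z, f k z ≤ B) (S : Fin n → Z) (i : Fin n) (z : Z) :
    |supDev D f (Function.update S i z) - supDev D f S| ≤ B :=
  abs_ciSup_sub_ciSup_le (bddAbove_deviation D hf h0 hB _) (bddAbove_deviation D hf h0 hB _)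
    fun k => by
      rw [sub_sub_sub_cancel_left, abs_sub_comm]
      exact abs_sum_update_sub_le (h0 k) (hB k) S i z

/-- Ghost sample: the expectation is a mean over an independent copy `S'`, and a supremum of
integrals is at most the integral of the supremum. -/
lemma supDev_le_integral_symmDev [Countable ι] [Nonempty ι] (hf : ∀ k, Measurable (f k))
    (h0 : ∀ k z, 0 ≤ f k z) (hB : ∀ k z, f k z ≤ B) (S : Fin n → Z) :
    supDev D f S ≤
      ∫ S', symmDev f 1 (fun i => (S i, S' i)) ∂(Measure.pi fun _ : Fin n => D) := by
  set P := Measure.pi fun _ : Fin n => D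
  refine ciSup_le fun k => ?_
  have hev : ∀ i : Fin n, Integrable (fun S' : Fin n → Z => f k (S' i)) P := fun i =>
    integrable_of_abs_le (K := B) ((hf k).comp (measurable_pi_apply i)) fun z => by
      rw [abs_of_nonneg (h0 k _)]; exact hB k _
  have h1 : n * ∫ z, f k z ∂D - ∑ i, f k (S i) =
      ∫ S', signSum 1 (fun i => f k (S' i) - f k (S i)) ∂P := by
    simp only [signSum, Pi.one_apply, Units.val_one, Int.cast_one, one_mul]
    have hsub : ∀ i ∈ univ, Integrable (fun S' : Fin n → Z => f k (S' i) - f k (S i)) P :=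
      fun i _ => (hev i).sub (integrable_const _)
    rw [integral_finsetSum _ hsub]
    have h2 : ∀ i, ∫ S', (f k (S' i) - f k (S i)) ∂P = ∫ z, f k z ∂D - f k (S i) := fun i => by
      rw [integral_sub (hev i) (integrable_const _),
        integral_comp_eval (μ := fun _ : Fin n => D) (f := f k) (hf k).aestronglyMeasurable]
      simp
    simp [h2, sum_sub_distrib]
  rw [h1]
  have hpair : Measurable fun S' : Fin n → Z => fun i => (S i, S' i) :=
    measurable_pi_iff.2 fun i => measurable_const.prodMk (measurable_pi_apply i)
  refine integral_mono ?_ ?_ fun S' =>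
    le_ciSup (bddAbove_signSum_diff h0 hB 1 fun i => (S i, S' i)) k
  · exact integrable_of_abs_le (K := n * B)
      (measurable_signSum 1 fun i => ((hf k).comp (measurable_pi_apply i)).sub_const _)
      fun S' => signSum_diff_le h0 hB 1 (fun i => (S i, S' i)) k
  · exact integrable_of_abs_le ((measurable_symmDev hf 1).comp hpair) fun S' =>
      abs_symmDev_le h0 hB 1 _

/-- Swapping the entries of each pair with `σ i = -1` preserves the law of the pairs and produces
the signs. -/
lemma integral_symmDev_eq [Countable ι] (hf : ∀ k, Measurable (f k)) (σ : Fin n → ℤˣ) :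
    ∫ T, symmDev f σ T ∂(Measure.pi fun _ : Fin n => D.prod D) =
      ∫ T, symmDev f 1 T ∂(Measure.pi fun _ : Fin n => D.prod D) := by
  have mp := measurePreserving_pi (fun _ : Fin n => D.prod D) (fun _ : Fin n => D.prod D)
    (f := fun i => if σ i = 1 then id else Prod.swap) fun i => by
      by_cases h : σ i = 1
      · simp only [h, if_true]
        exact MeasurePreserving.id _
      · simp only [h, if_false]
        exact Measure.measurePreserving_swap
  conv_rhs => rw [← mp.map_eq]
  rw [integral_map mp.aemeasurable (measurable_symmDev hf 1).aestronglyMeasurable]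
  refine integral_congr_ae (Filter.Eventually.of_forall fun T => ?_)
  simp only [symmDev, signSum]
  refine iSup_congr fun k => sum_congr rfl fun i _ => ?_
  rcases Int.units_eq_one_or (σ i) with h | h
  · simp [h]
  · simp [h]

/-- **Symmetrization**: the expected largest deviation is at most twice a uniform bound on the
empirical Rademacher averages. -/
lemma integral_supDev_le [Countable ι] [Nonempty ι] (hf : ∀ k, Measurable (f k))
    (h0 : ∀ k z, 0 ≤ f k z) (hB : ∀ k z, f k z ≤ B) {ρ : ℝ}
    (hM : ∀ S : Fin n → Z, ∃ M : (Fin n → ℤˣ) → ℝ,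
      (∀ σ k, signSum σ (fun i => f k (S i)) ≤ M σ) ∧ 𝔼 σ, M σ ≤ ρ) :
    ∫ S, supDev D f S ∂(Measure.pi fun _ : Fin n => D) ≤ 2 * ρ := by
  set P := Measure.pi fun _ : Fin n => D
  set Q := Measure.pi fun _ : Fin n => D.prod D
  have hQ : ∀ σ, Integrable (symmDev f σ) Q := fun σ =>
    integrable_of_abs_le (measurable_symmDev hf σ) (abs_symmDev_le h0 hB σ)
  have hmp := (measurePreserving_arrowProdEquivProdArrow Z Z (Fin n) (fun _ => D)
    (fun _ => D)).symm
  have hm2 : Measurable fun x : (Fin n → Z) × (Fin n → Z) =>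
      symmDev f 1 (fun i => (x.1 i, x.2 i)) :=
    (measurable_symmDev hf 1).comp (by fun_prop)
  have hint2 : Integrable (fun x : (Fin n → Z) × (Fin n → Z) =>
      symmDev f 1 (fun i => (x.1 i, x.2 i))) (P.prod P) :=
    integrable_of_abs_le hm2 fun x => abs_symmDev_le h0 hB 1 _
  have hswap : ∫ S, ∫ S', symmDev f 1 (fun i => (S i, S' i)) ∂P ∂P = ∫ T, symmDev f 1 T ∂Q := by
    rw [← integral_prod _ hint2]
    exact hmp.integral_comp' (symmDev f 1)
  have hpt : ∀ T : Fin n → Z × Z, 𝔼 σ, symmDev f σ T ≤ 2 * ρ := fun T => by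
    obtain ⟨M, hM1, hM2⟩ := hM fun i => (T i).2
    obtain ⟨N, hN1, hN2⟩ := hM fun i => (T i).1
    -- The subtracted half is a signed sum for `-σ`, and `N (-σ)` has the same average as `N σ`.
    calc 𝔼 σ, symmDev f σ T ≤ 𝔼 σ, (M σ + N (-σ)) := by
          refine expect_le_expect fun σ _ => ciSup_le fun k => ?_
          have h1 := hM1 σ k
          have h2 := hN1 (-σ) k
          have h3 := signSum_sub σ (fun i => f k (T i).2) (fun i => f k (T i).1)
          rw [signSum_neg] at h2
          change signSum σ ((fun i => f k (T i).2) - fun i => f k (T i).1) ≤ _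
          linarith
      _ = 𝔼 σ, M σ + 𝔼 σ, N σ := by
          rw [expect_add_distrib]
          congr 1
          exact Fintype.expect_equiv (Equiv.neg (Fin n → ℤˣ)) _ _ fun _ => rfl
      _ ≤ 2 * ρ := by linarith
  calc ∫ S, supDev D f S ∂P ≤ ∫ S, ∫ S', symmDev f 1 (fun i => (S i, S' i)) ∂P ∂P :=
        integral_mono (integrable_of_abs_le (measurable_supDev D hf) (abs_supDev_le D hf h0 hB))
          hint2.integral_prod_left fun S => supDev_le_integral_symmDev D hf h0 hB S
    _ = ∫ T, symmDev f 1 T ∂Q := hswap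
    _ = 𝔼 σ : Fin n → ℤˣ, ∫ T, symmDev f σ T ∂Q := by
        exact (Fintype.expect_const _).symm.trans
          (expect_congr rfl fun σ _ => (integral_symmDev_eq D hf σ).symm)
    _ = ∫ T, 𝔼 σ, symmDev f σ T ∂Q := by
        simp_rw [Fintype.expect_eq_sum_div_card]
        rw [integral_div, integral_finsetSum _ fun σ _ => hQ σ]
    _ ≤ ∫ _, 2 * ρ ∂Q := by
        refine integral_mono ?_ (integrable_const _) hpt
        simp_rw [Fintype.expect_eq_sum_div_card]
        exact (integrable_finsetSum _ fun σ _ => hQ σ).div_const _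
    _ = 2 * ρ := by simp

/-- Uniform convergence for a countable class with values in `[0, B]`. -/
lemma uniform_upper_deviation [Countable ι] [Nonempty ι] (hf : ∀ k, Measurable (f k))
    (h0 : ∀ k z, 0 ≤ f k z) (hB : ∀ k z, f k z ≤ B) (hB0 : 0 < B) (hn : 1 ≤ n) {ρ δ : ℝ}
    (hδ : 0 < δ) (hδ1 : δ < 1)
    (hM : ∀ S : Fin n → Z, ∃ M : (Fin n → ℤˣ) → ℝ,
      (∀ σ k, signSum σ (fun i => f k (S i)) ≤ M σ) ∧ 𝔼 σ, M σ ≤ ρ) :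
    HoldsWithProbAtLeast (Measure.pi fun _ : Fin n => D) (1 - δ) fun S =>
      ∀ k, n * ∫ z, f k z ∂D - ∑ i, f k (S i) ≤
        2 * ρ + B * √(2 * n * Real.log (1 / δ)) := by
  obtain ⟨E, hE, hPE, hES⟩ := bounded_differences_upper_tail D hB0 hδ hδ1 hn (supDev D f)
    (measurable_supDev D hf) (abs_supDev_le D hf h0 hB) (abs_supDev_update_sub_le D hf h0 hB)
  refine ⟨E, hE, hPE, fun S hS k => ?_⟩
  have h1 := hES S hS
  have h2 := integral_supDev_le D hf h0 hB hM
  have h3 := le_ciSup (bddAbove_deviation D hf h0 hB S) k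
  change _ ≤ supDev D f S at h3
  linarith

/-- **Hoeffding's inequality** for the sum of a function with values in `[0, B]`. -/
lemma sum_upper_deviation {g : Z → ℝ} (hg : Measurable g) (h0 : ∀ z, 0 ≤ g z)
    (hB : ∀ z, g z ≤ B) (hB0 : 0 < B) (hn : 1 ≤ n) {δ : ℝ} (hδ : 0 < δ) (hδ1 : δ < 1) :
    HoldsWithProbAtLeast (Measure.pi fun _ : Fin n => D) (1 - δ) fun S =>
      ∑ i, g (S i) ≤ n * ∫ z, g z ∂D + B * √(2 * n * Real.log (1 / δ)) := by
  have hm : Measurable fun S : Fin n → Z => ∑ i, g (S i) := by fun_prop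
  have h := bounded_differences_upper_tail D hB0 hδ hδ1 hn (fun S => ∑ i, g (S i)) hm
    (K := n * B) (fun S => by
      rw [abs_of_nonneg (sum_nonneg fun i _ => h0 _)]
      simpa using sum_le_sum fun i (_ : i ∈ univ) => hB (S i))
    (abs_sum_update_sub_le h0 hB)
  have hmean : ∫ S, ∑ i, g (S i) ∂(Measure.pi fun _ : Fin n => D) = n * ∫ z, g z ∂D := by
    have hint : ∀ i ∈ univ, Integrable (fun S : Fin n → Z => g (S i))
        (Measure.pi fun _ : Fin n => D) := fun i _ =>
      integrable_of_abs_le (K := B) (hg.comp (measurable_pi_apply i)) fun S => by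
        rw [abs_of_nonneg (h0 _)]; exact hB _
    rw [integral_finsetSum _ hint]
    have : ∀ i : Fin n, ∫ S, g (S i) ∂(Measure.pi fun _ : Fin n => D) = ∫ z, g z ∂D := fun i =>
      integral_comp_eval (μ := fun _ : Fin n => D) (f := g) hg.aestronglyMeasurable
    simp [this]
  rwa [hmean] at h

end Symmetrization

/-! ### Calculus of high-probability events. -/

lemma HoldsWithProbAtLeast.mono {Ω : Type*} [MeasurableSpace Ω] {P : Measure Ω} {p : ℝ}
    {A A' : Ω → Prop} (h : HoldsWithProbAtLeast P p A) (hA : ∀ ω, A ω → A' ω) :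
    HoldsWithProbAtLeast P p A' := by
  obtain ⟨E, hE, hP, h⟩ := h
  exact ⟨E, hE, hP, fun ω hω => hA ω (h ω hω)⟩

lemma holdsWithProbAtLeast_of_forall {Ω : Type*} [MeasurableSpace Ω] {P : Measure Ω}
    [IsProbabilityMeasure P] {p : ℝ} (hp : p ≤ 1) {A : Ω → Prop} (h : ∀ ω, A ω) :
    HoldsWithProbAtLeast P p A :=
  ⟨Set.univ, MeasurableSet.univ, by simpa using hp, fun ω _ => h ω⟩

/-- The union bound. -/
lemma HoldsWithProbAtLeast.and {Ω : Type*} [MeasurableSpace Ω] {P : Measure Ω}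
    [IsProbabilityMeasure P] {δ δ' : ℝ} {A A' : Ω → Prop}
    (h : HoldsWithProbAtLeast P (1 - δ) A) (h' : HoldsWithProbAtLeast P (1 - δ') A') :
    HoldsWithProbAtLeast P (1 - (δ + δ')) fun ω => A ω ∧ A' ω := by
  obtain ⟨E, hE, hP, h⟩ := h
  obtain ⟨E', hE', hP', h'⟩ := h'
  refine ⟨E ∩ E', hE.inter hE', ?_, fun ω hω => ⟨h ω hω.1, h' ω hω.2⟩⟩
  rw [ENNReal.ofReal_le_iff_le_toReal (measure_ne_top _ _)] at hP hP' ⊢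
  change 1 - δ ≤ P.real E at hP
  change 1 - δ' ≤ P.real E' at hP'
  change _ ≤ P.real (E ∩ E')
  have h1 := measureReal_union_add_inter (μ := P) (s := E) hE'
  have h2 : P.real (E ∪ E') ≤ 1 := measureReal_le_one
  linarith

/-! ### Deviation bounds for the ranking loss. -/

section Loss

variable {m d n : ℕ} {G W R B δ : ℝ} {Y : Set (Fin m → ℝ)} {φ : (Fin m → ℝ) → Y → ℝ}

lemma IsLipschitzLoss.continuous (hφ : IsLipschitzLoss φ G) (y : Y) :
    Continuous fun s => φ s y :=
  (LipschitzWith.of_dist_le' fun s s' => by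
    rw [Real.dist_eq, dist_eq_norm]
    exact hφ y s s').continuous

/-- `φ` is a Carathéodory function, continuous in the score and measurable in the label, hence
jointly measurable. -/
lemma measurable_exampleLoss (hφ : IsLipschitzLoss φ G) (hmeas : ∀ s, Measurable (φ s))
    (w : Fin d → ℝ) : Measurable (exampleLoss φ w : Example m d R Y → ℝ) := by
  have h1 : Measurable (Function.uncurry fun y s => φ s y) :=
    (measurable_uncurry_of_continuous_of_measurable (u := φ) hφ.continuous hmeas).comp
      measurable_swap
  refine h1.comp (measurable_snd.prodMk (measurable_pi_iff.2 fun j => ?_))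
  have h2 : ∀ i, Measurable fun z : Example m d R Y => z.1.1 j i * w i := fun i =>
    ((measurable_pi_apply i).comp ((measurable_pi_apply j).comp
      (measurable_subtype_coe.comp measurable_fst))).mul_const _
  exact Finset.measurable_sum univ fun i _ => h2 i

lemma continuous_exampleLoss (hφ : IsLipschitzLoss φ G) (z : Example m d R Y) :
    Continuous fun w : Fin d → ℝ => exampleLoss φ w z :=
  (hφ.continuous z.2).comp (continuous_const.matrix_mulVec continuous_id)

variable (D : Measure (Example m d R Y))

/-- The degenerate case `B = 0`, excluded from the deviation inequalities, which need a positive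
difference bound. -/
lemma losses_eq_zero (h0 : ∀ s y, 0 ≤ φ s y)
    (hB : ∀ w ∈ L1Class d W, ∀ z : Example m d R Y, exampleLoss φ w z ≤ 0)
    {w : Fin d → ℝ} (hw : w ∈ L1Class d W) (S : Fin n → Example m d R Y) :
    expectedLoss φ D w = 0 ∧ empiricalLoss φ S w = 0 := by
  have h : ∀ z : Example m d R Y, exampleLoss φ w z = 0 := fun z =>
    le_antisymm (hB w hw z) (h0 _ _)
  simp [expectedLoss, empiricalLoss, h]

lemma sqrt_mul_div_eq (hn : 1 ≤ n) (L : ℝ) : √(n * L) / n = √(L / n) := by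
  have hn' : (0 : ℝ) < n := by exact_mod_cast hn
  rw [Real.sqrt_mul hn'.le, Real.sqrt_div' _ hn'.le]
  nth_rewrite 2 [← Real.mul_self_sqrt hn'.le]
  have : √(n : ℝ) ≠ 0 := (Real.sqrt_pos.2 hn').ne'
  field_simp

variable [IsProbabilityMeasure D]

lemma continuous_expectedLoss (hφ : IsLipschitzLoss φ G) (hmeas : ∀ s, Measurable (φ s))
    (h0 : ∀ s y, 0 ≤ φ s y)
    (hB : ∀ w ∈ L1Class d W, ∀ z : Example m d R Y, exampleLoss φ w z ≤ B) :
    Continuous fun w : L1Class d W => expectedLoss φ D w :=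
  continuous_of_dominated (bound := fun _ => B)
    (fun w => (measurable_exampleLoss hφ hmeas w.1).aestronglyMeasurable)
    (fun w => Filter.Eventually.of_forall fun z => by
      rw [Real.norm_eq_abs, abs_of_nonneg (show 0 ≤ exampleLoss φ w.1 z from h0 _ _)]
      exact hB w w.2 z)
    (integrable_const B)
    (Filter.Eventually.of_forall fun z => (continuous_exampleLoss hφ z).comp continuous_subtype_val)

/-- Uniform convergence over the `ℓ¹` ball. -/
lemma expectedLoss_le_uniformly (hm : 1 ≤ m) (hd : 2 ≤ d) (hn : 1 ≤ n) (hG : 0 ≤ G) (hW : 0 ≤ W)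
    (hR : 0 ≤ R) (hδ : 0 < δ) (hδ1 : δ < 1) (hB0 : 0 ≤ B) (hmeas : ∀ s, Measurable (φ s))
    (h0 : ∀ s y, 0 ≤ φ s y) (hφ : IsLipschitzLoss φ G)
    (hB : ∀ w ∈ L1Class d W, ∀ z : Example m d R Y, exampleLoss φ w z ≤ B) :
    HoldsWithProbAtLeast (Measure.pi fun _ : Fin n => D) (1 - δ) fun S =>
      ∀ w ∈ L1Class d W, expectedLoss φ D w ≤ empiricalLoss φ S w +
        (224 * (1 + Real.log (m * n)) ^ 2 * (G * W * R * √(Real.log d / n)) +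
          2 * (B * √(Real.log (1 / δ) / n))) := by
  rcases hB0.eq_or_lt with rfl | hB0
  · refine holdsWithProbAtLeast_of_forall (by linarith) fun S w hw => ?_
    obtain ⟨h1, h2⟩ := losses_eq_zero D h0 hB hw S
    rw [h1, h2]
    positivity
  have hn' : (0 : ℝ) < n := by exact_mod_cast hn
  have hne : Nonempty (L1Class d W) := ⟨⟨0, by simpa [L1Class] using hW⟩⟩
  -- A dense sequence of weights makes the class countable; the bound is a closed condition in `w`,
  -- so it passes to the ball.
  set f : ℕ → Example m d R Y → ℝ := fun k =>
    exampleLoss φ (TopologicalSpace.denseSeq (L1Class d W) k : L1Class d W)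
  have h := uniform_upper_deviation D (f := f) (n := n) (B := B)
    (fun k => measurable_exampleLoss hφ hmeas _)
    (fun k z => h0 _ _) (fun k z => hB _ (Subtype.prop _) z) hB0 hn hδ hδ1
    (fun S => by
      obtain ⟨M, hM, hM'⟩ := exists_majorant_exampleLoss (W := W) hm hn hd hG hW hR hφ S
      exact ⟨M, fun σ k => hM σ _, hM'⟩)
  refine h.mono fun S hS w hw => ?_
  set c : ℝ := 2 * (112 * (1 + Real.log (m * n)) ^ 2 * (G * W * R * (√n * √(Real.log d)))) +
    B * √(2 * n * Real.log (1 / δ)) with hc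
  have hall : ∀ w : L1Class d W,
      n * expectedLoss φ D w - ∑ i, exampleLoss φ w (S i) ≤ c := by
    have hcont : Continuous fun w : L1Class d W =>
        n * expectedLoss φ D w - ∑ i, exampleLoss φ w (S i) :=
      (continuous_const.mul (continuous_expectedLoss D hφ hmeas h0 hB)).sub
        (continuous_finsetSum _ fun i _ =>
          (continuous_exampleLoss hφ (S i)).comp continuous_subtype_val)
    have hclosed : IsClosed {w : L1Class d W |
        n * expectedLoss φ D w - ∑ i, exampleLoss φ w (S i) ≤ c} :=
      isClosed_le hcont continuous_const
    intro w
    exact (TopologicalSpace.denseRange_denseSeq (L1Class d W)).induction_on w hclosed hS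
  have h1 := hall ⟨w, hw⟩
  have h2 : c / n ≤ 224 * (1 + Real.log (m * n)) ^ 2 * (G * W * R * √(Real.log d / n)) +
      2 * (B * √(Real.log (1 / δ) / n)) := by
    rw [← sqrt_mul_div_eq hn, ← sqrt_mul_div_eq hn, hc, ← Real.sqrt_mul hn'.le, mul_assoc 2 (n : ℝ),
      Real.sqrt_mul (by norm_num : (0 : ℝ) ≤ 2)]
    have h3 : √(2 : ℝ) ≤ 2 := Real.sqrt_le_iff.2 (by norm_num)
    have h4 : √2 * (B * (√(n * Real.log (1 / δ)) / n)) ≤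
        2 * (B * (√(n * Real.log (1 / δ)) / n)) := by gcongr
    refine le_trans (le_of_eq ?_) (add_le_add le_rfl h4)
    ring
  have h5 : expectedLoss φ D w ≤ empiricalLoss φ S w + c / n := by
    rw [empiricalLoss, one_div, ← div_eq_inv_mul, ← add_div, le_div_iff₀ hn']
    simp only at h1
    linarith
  linarith

/-- With `w` fixed before the sample is drawn, no complexity term appears. -/
lemma empiricalLoss_le (hn : 1 ≤ n) (hδ : 0 < δ) (hδ1 : δ < 1) (hB0 : 0 ≤ B)
    (hmeas : ∀ s, Measurable (φ s)) (h0 : ∀ s y, 0 ≤ φ s y) (hφ : IsLipschitzLoss φ G)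
    (hB : ∀ w ∈ L1Class d W, ∀ z : Example m d R Y, exampleLoss φ w z ≤ B)
    {w : Fin d → ℝ} (hw : w ∈ L1Class d W) :
    HoldsWithProbAtLeast (Measure.pi fun _ : Fin n => D) (1 - δ) fun S =>
      empiricalLoss φ S w ≤ expectedLoss φ D w + 2 * (B * √(Real.log (1 / δ) / n)) := by
  rcases hB0.eq_or_lt with rfl | hB0
  · refine holdsWithProbAtLeast_of_forall (by linarith) fun S => ?_
    obtain ⟨h1, h2⟩ := losses_eq_zero D h0 hB hw S
    rw [h1, h2]
    simp
  have hn' : (0 : ℝ) < n := by exact_mod_cast hn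
  refine (sum_upper_deviation D (measurable_exampleLoss hφ hmeas w) (fun z => h0 _ _) (hB w hw)
    hB0 hn hδ hδ1).mono fun S hS => ?_
  rw [empiricalLoss, one_div, ← div_eq_inv_mul, div_le_iff₀ hn']
  refine hS.trans ?_
  rw [← sqrt_mul_div_eq hn, mul_assoc 2 (n : ℝ), Real.sqrt_mul (by norm_num : (0 : ℝ) ≤ 2)]
  have h3 : √(2 : ℝ) ≤ 2 := Real.sqrt_le_iff.2 (by norm_num)
  have h4 : √2 * (B * √(n * Real.log (1 / δ))) ≤ 2 * (B * √(n * Real.log (1 / δ))) := by gcongr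
  have h5 : (expectedLoss φ D w + 2 * (B * (√(n * Real.log (1 / δ)) / n))) * n =
      n * expectedLoss φ D w + 2 * (B * √(n * Real.log (1 / δ))) := by field_simp
  rw [h5, expectedLoss]
  linarith

end Loss

end LearningToRank

open LearningToRank
-- The two risk bounds.
theorem mainTheorem4 :
    ∃ C : ℝ, 0 < C ∧ ∃ k : ℕ,
      ∀ (m d n : ℕ) (G W R B δ : ℝ) (Y : Set (Fin m → ℝ))
        (φ : (Fin m → ℝ) → Y → ℝ) (D : Measure (Example m d R Y)),
        1 ≤ m → 2 ≤ d → 1 ≤ n →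
        0 ≤ G → 0 ≤ W → 0 ≤ R → 0 < δ → δ < 1 →
        IsProbabilityMeasure D →
        (∀ s, Measurable (φ s)) →
        (∀ s y, 0 ≤ φ s y) →
        IsLipschitzLoss φ G →
        (∀ w ∈ L1Class d W, ∀ z : Example m d R Y, exampleLoss φ w z ≤ B) →
        HoldsWithProbAtLeast (Measure.pi fun _ : Fin n => D) (1 - δ)
          (fun S => ∀ w ∈ L1Class d W,
            expectedLoss φ D w ≤ empiricalLoss φ S w + errorTerm C k m d n G W R B δ) ∧
        HoldsWithProbAtLeast (Measure.pi fun _ : Fin n => D) (1 - 2 * δ)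
          (fun S => ∀ wHat wStar : Fin d → ℝ,
            IsMinimizerOver (empiricalLoss φ S) (L1Class d W) wHat →
            IsMinimizerOver (expectedLoss φ D) (L1Class d W) wStar →
            expectedLoss φ D wHat ≤
              expectedLoss φ D wStar + errorTerm C k m d n G W R B δ) := by
  -- `224 = 2 * 112`: symmetrization doubles the Rademacher constant.
  refine ⟨224, by norm_num, 2, ?_⟩
  intro m d n G W R B δ Y φ D hm hd hn hG hW hR hδ hδ1 hD hmeas h0 hφ hB
  have hne : Nonempty (Example m d R Y) := nonempty_of_isProbabilityMeasure D
  -- `B` bounds a nonnegative loss, that of the zero weight on some example.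
  have hB0 : 0 ≤ B := (h0 _ _).trans (hB 0 (by simpa [L1Class] using hW) hne.some)
  have hm1 : (1 : ℝ) ≤ m := by exact_mod_cast hm
  have hn1 : (1 : ℝ) ≤ n := by exact_mod_cast hn
  have hl : 0 ≤ Real.log ((m : ℝ) * n) :=
    Real.log_nonneg (one_le_mul_of_one_le_of_one_le hm1 hn1)
  have hb : 0 ≤ B * √(Real.log (1 / δ) / n) := by positivity
  -- Both confidence terms of the excess-risk bound fit, so one constant serves both claims.
  have herr : 224 * (1 + Real.log (m * n)) ^ 2 * (G * W * R * √(Real.log d / n)) +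
      2 * (B * √(Real.log (1 / δ) / n)) + 2 * (B * √(Real.log (1 / δ) / n)) ≤
        errorTerm 224 2 m d n G W R B δ := by
    rw [errorTerm, mul_add]
    have : 4 * (B * √(Real.log (1 / δ) / n)) ≤
        224 * (1 + Real.log (m * n)) ^ 2 * (B * √(Real.log (1 / δ) / n)) := by
      refine mul_le_mul_of_nonneg_right ?_ hb
      nlinarith
    linarith
  have hunif := expectedLoss_le_uniformly D hm hd hn hG hW hR hδ hδ1 hB0 hmeas h0 hφ hB
  refine ⟨hunif.mono fun S hS w hw => (hS w hw).trans (by linarith), ?_⟩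
  -- The Hoeffding event must not depend on `wStar`: one minimizer `w₀` is fixed, and all others
  -- share its expected loss. Without a minimizer the claim is vacuous.
  by_cases hex : ∃ w, IsMinimizerOver (expectedLoss φ D) (L1Class d W) w
  · obtain ⟨w₀, hw₀, hmin⟩ := hex
    rw [two_mul]
    refine (hunif.and (empiricalLoss_le D hn hδ hδ1 hB0 hmeas h0 hφ hB hw₀)).mono ?_
    rintro S ⟨h1, h2⟩ wHat wStar hHat hStar
    have h3 := h1 wHat hHat.1
    have h4 := hHat.2 w₀ hw₀
    have h5 := hmin wStar hStar.1
    linarith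
  · exact holdsWithProbAtLeast_of_forall (by linarith) fun S _ wStar _ h =>
      (hex ⟨wStar, h⟩).elim
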